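/- There exist universal constants $\beta\in[1,+\infty)$ and $\gamma_{10},\gamma_{11}\in(0,+\infty)$ with the following property. Let $\alpha\in[0,1)$, let $\kappa_n$, $\theta_n$ ($n=1,2,\ldots$) be random variables on a probability space, all of them (both sequences together) independent, such that $\mathbb P(\kappa_n=0)=1-\mathbb P(\kappa_n=1)=\alpha$ and each $\theta_n$ is exponentially distributed with expectation $1$, and let $a_1\ge a_2\ge\ldots$ be non-negative reals with $\sum_{n\ge1}a_n<+\infty$ and $a_1>0$. Then the series in $$\sigma=a_1\theta_1+\sum_{n>1}a_n\kappa_n\theta_n$$ converges almost surely, and for every real $p\ge2$ $$\mathbb P\Bigl(\sigma\ge\gamma_{10}\Bigl(p\,a_1+(1-\alpha)\sum_{n>1}a_n\Bigr)\Bigr)\le e^{-p}$$ and $$\mathbb P\Bigl(\sigma\ge\gamma_{11}\Bigl(p\,a_1+(1-\alpha)\sum_{n>1}a_n\Bigr)\Bigr)\ge\tfrac12e^{-\beta p}.$$ The constants $\beta,\gamma_{10},\gamma_{11}$ do not depend on $\alpha$, $p$, the sequence $(a_n)$, or the random variables. -/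

import Mathlib

open MeasureTheory ProbabilityTheory

/-- The random variable `a₁ θ₁ + ∑_{n > 1} aₙ κₙ θₙ`. Sequences indexed by `1, 2, 3, …` are
written as functions on `ℕ`, so `a 0` is the first coefficient `a₁` and `a (n + 1)`, `n : ℕ`, are
the coefficients with index greater than one. -/
noncomputable def mixtureSum {Ω : Type*} (a : ℕ → ℝ) (κ θ : ℕ → Ω → ℝ) (ω : Ω) : ℝ :=
  a 0 * θ 0 ω + ∑' n : ℕ, a (n + 1) * κ (n + 1) ω * θ (n + 1) ω

/-- The quantity `p · a₁ + (1 - α) ∑_{n > 1} aₙ`, with the same indexing. -/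
noncomputable def mixtureScale (α : ℝ) (a : ℕ → ℝ) (p : ℝ) : ℝ :=
  p * a 0 + (1 - α) * ∑' n : ℕ, a (n + 1)

open Filter Topology
open scoped ENNReal

/-! Write σ = a₁θ₁ + Y and Q = (1 - α) ∑_{n>1} aₙ = E Y. The first term supplies the exponential
tail at scale p·a₁; Y is controlled by Chernoff bounds in both directions, both contained in
`measureReal_mul_le_mul_tsum_le`. Since aₙ ≤ a₁, exponents of order 1/a₁ are admissible. Upper
bound: θ₁ and Y each exceed their share with probability at most e^{-2p}. Lower bound: if Q is at
most 2p·a₁, then θ₁ ≥ p/2 suffices; otherwise Y ≥ Q/4 has probability at least 1/2. This gives β =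
1, γ₁₀ = 6, γ₁₁ = 1/6. -/

lemma lintegral_exp_mul_expMeasure_one {s : ℝ} (hs : s < 1) :
    ∫⁻ x, ENNReal.ofReal (Real.exp (s * x)) ∂expMeasure 1 = ENNReal.ofReal (1 / (1 - s)) := by
  have hs' : 0 < 1 - s := by linarith
  have hpdf : ∀ r, gammaPDF 1 r = exponentialPDF r := fun r => rfl
  have hm : ∀ r, Measurable (exponentialPDF r) := fun r =>
    (measurable_exponentialPDFReal r).ennreal_ofReal
  rw [expMeasure, gammaMeasure, hpdf, lintegral_withDensity_eq_lintegral_mul _ (hm 1) (by fun_prop)]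
  -- Exponential tilting: the integrand is a multiple of the density of rate `1 - s`.
  have h : ∀ x, (exponentialPDF 1 * fun x => ENNReal.ofReal (Real.exp (s * x))) x
      = ENNReal.ofReal (1 / (1 - s)) * exponentialPDF (1 - s) x := by
    intro x
    rw [Pi.mul_apply, exponentialPDF_eq, exponentialPDF_eq]
    split_ifs with hx
    · rw [← ENNReal.ofReal_mul (by positivity), ← ENNReal.ofReal_mul (by positivity), one_mul,
        ← Real.exp_add, ← mul_assoc, one_div_mul_cancel hs'.ne', one_mul]
      ring_nf
    · simp
  rw [lintegral_congr h, lintegral_const_mul _ (hm _),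
    lintegral_exponentialPDF_eq_one hs', mul_one]

lemma expMeasure_one_Ici {x : ℝ} (hx : 0 ≤ x) :
    (expMeasure 1).real (Set.Ici x) = Real.exp (-x) := by
  have : IsProbabilityMeasure (expMeasure 1) := isProbabilityMeasure_expMeasure one_pos
  have : NullSingletonClass (expMeasure 1) :=
    ⟨fun y => withDensity_absolutelyContinuous _ _ (measure_singleton y)⟩
  have h := cdf_expMeasure_eq one_pos x
  rw [cdf_eq_real, if_pos hx, one_mul] at h
  have h2 := probReal_compl_eq_one_sub (μ := expMeasure 1) (measurableSet_Iic (a := x))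
  rw [Set.compl_Iic, h] at h2
  rw [measureReal_congr Ioi_ae_eq_Ici.symm, h2]
  ring

lemma ae_nonneg_of_hasLaw_expMeasure {Ω : Type*} [MeasurableSpace Ω] {μ : Measure Ω}
    [IsProbabilityMeasure μ] {X : Ω → ℝ} (hm : Measurable X) (hX : HasLaw X (expMeasure 1) μ) :
    ∀ᵐ ω ∂μ, 0 ≤ X ω := by
  have h := hX.measureReal_eq (measurableSet_Ici (a := (0 : ℝ)))
  have h' : (expMeasure 1).real {x : ℝ | 0 ≤ x} = 1 :=
    (expMeasure_one_Ici le_rfl).trans (by simp)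
  exact (mem_ae_iff_prob_eq_one (hm measurableSet_Ici)).2
    ((ENNReal.toReal_eq_one_iff _).1 (h.trans h'))

/-! ### Bernoulli–exponential products and independence -/

section Mixture

variable {Ω : Type*} [MeasurableSpace Ω] {μ : Measure Ω} [IsProbabilityMeasure μ] {α : ℝ}

lemma ae_eq_zero_or_one {K : Ω → ℝ} (hm : Measurable K)
    (h0 : μ.real {ω | K ω = 0} = α) (h1 : μ.real {ω | K ω = 1} = 1 - α) :
    ∀ᵐ ω ∂μ, K ω = 0 ∨ K ω = 1 := by
  have hd : Disjoint {ω | K ω = 0} {ω | K ω = 1} := by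
    rw [Set.disjoint_left]
    intro ω h h'
    simp_all
  have m0 : MeasurableSet {ω | K ω = 0} := hm (measurableSet_singleton 0)
  have m1 : MeasurableSet {ω | K ω = 1} := hm (measurableSet_singleton 1)
  have h := measureReal_union (μ := μ) hd m1
  rw [h0, h1, add_sub_cancel] at h
  exact (mem_ae_iff_prob_eq_one (m0.union m1)).2 ((ENNReal.toReal_eq_one_iff _).1 h)

lemma lintegral_exp_bernoulli_mul_exponential {K T : Ω → ℝ} (hK : Measurable K)
    (hT : Measurable T) (hKT : IndepFun K T μ) (hα : 0 ≤ α) (hα1 : α < 1)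
    (h0 : μ.real {ω | K ω = 0} = α) (h1 : μ.real {ω | K ω = 1} = 1 - α)
    (hlaw : HasLaw T (expMeasure 1) μ) {s : ℝ} (hs : s < 1) :
    ∫⁻ ω, ENNReal.ofReal (Real.exp (s * (K ω * T ω))) ∂μ
      = ENNReal.ofReal (1 + (1 - α) * (s / (1 - s))) := by
  have hs' : 0 < 1 - s := by linarith
  have m0 : MeasurableSet {ω | K ω = 0} := hK (measurableSet_singleton 0)
  have m1 : MeasurableSet {ω | K ω = 1} := hK (measurableSet_singleton 1)
  let f : ℝ → ℝ≥0∞ := Set.indicator {1} 1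
  have hf : Measurable f := measurable_one.indicator (measurableSet_singleton 1)
  let g : ℝ → ℝ≥0∞ := fun x => ENNReal.ofReal (Real.exp (s * x))
  have hg : Measurable g := by fun_prop
  have hae : ∀ᵐ ω ∂μ, ENNReal.ofReal (Real.exp (s * (K ω * T ω)))
      = Set.indicator {ω | K ω = 0} 1 ω + f (K ω) * g (T ω) := by
    filter_upwards [ae_eq_zero_or_one hK h0 h1] with ω hω
    rcases hω with h | h <;> simp [h, f, g]
  have hfK : ∫⁻ ω, f (K ω) ∂μ = ENNReal.ofReal (1 - α) := by
    have : ∀ ω, f (K ω) = Set.indicator {ω | K ω = 1} 1 ω := fun ω => by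
      simp [f, Set.indicator_apply, -Set.indicator_singleton]
    rw [lintegral_congr this, lintegral_indicator_one m1, ← h1,
      ofReal_measureReal]
  rw [lintegral_congr_ae hae, lintegral_add_left (measurable_one.indicator m0),
    lintegral_indicator_one m0,
    lintegral_mul_eq_lintegral_mul_lintegral_of_indepFun'' (f := fun ω => f (K ω))
      (g := fun ω => g (T ω)) (hf.comp hK).aemeasurable
      (hg.comp hT).aemeasurable (hKT.comp hf hg), hfK,
    hlaw.lintegral_comp hg.aemeasurable, lintegral_exp_mul_expMeasure_one hs, ← ofReal_measureReal,
    h0, ← ENNReal.ofReal_mul (by linarith), ← ENNReal.ofReal_add hα]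
  · congr 1
    field_simp
    ring
  · have : 0 ≤ 1 - α := by linarith
    positivity

/-- Induction on `n`: the factors before the last and the last factor depend on disjoint finite
blocks of the joint independent family. -/
lemma lintegral_prod_eq_prod_lintegral_of_iIndepFun_sumElim {κ θ : ℕ → Ω → ℝ}
    (hκ : ∀ n, Measurable (κ n)) (hθ : ∀ n, Measurable (θ n))
    (hind : iIndepFun (Sum.elim κ θ) μ) {G : ℕ → ℝ × ℝ → ℝ≥0∞} (hG : ∀ n, Measurable (G n))
    (n : ℕ) :
    ∫⁻ ω, ∏ i ∈ Finset.range n, G i (κ i ω, θ i ω) ∂μ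
      = ∏ i ∈ Finset.range n, ∫⁻ ω, G i (κ i ω, θ i ω) ∂μ := by
  induction n with
  | zero => simp
  | succ n ih =>
    simp_rw [Finset.prod_range_succ]
    rw [← ih]
    let S : Finset (ℕ ⊕ ℕ) := (Finset.range n).disjSum (Finset.range n)
    let T : Finset (ℕ ⊕ ℕ) := {Sum.inl n, Sum.inr n}
    have hST : Disjoint S T := by
      simp [S, T]
    have hm : ∀ i, Measurable (Sum.elim κ θ i) := by
      rintro (i | i)
      exacts [hκ i, hθ i]
    have hφ : Measurable fun x : S → ℝ => ∏ i : Finset.range n,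
        G i (x ⟨Sum.inl i, by simp [S]⟩,
          x ⟨Sum.inr i, by simp [S]⟩) := by
      refine Finset.measurable_prod _ fun i _ => (hG i).comp ?_
      fun_prop
    have hψ : Measurable fun x : T → ℝ =>
        G n (x ⟨Sum.inl n, by simp [T]⟩, x ⟨Sum.inr n, by simp [T]⟩) := by
      refine (hG n).comp ?_
      fun_prop
    have h := (hind.indepFun_finset S T hST hm).comp hφ hψ
    have hc : ∀ ω, ∏ i : Finset.range n, G i (κ i ω, θ i ω)
        = ∏ i ∈ Finset.range n, G i (κ i ω, θ i ω) := fun ω =>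
      Finset.prod_coe_sort (Finset.range n) fun i => G i (κ i ω, θ i ω)
    refine lintegral_mul_eq_lintegral_mul_lintegral_of_indepFun''
      (Finset.measurable_fun_prod _ fun i _ => ?_).aemeasurable ?_ ?_
    · exact (hG i).comp ((hκ i).prodMk (hθ i))
    · exact ((hG n).comp ((hκ n).prodMk (hθ n))).aemeasurable
    · simp_rw [← hc]
      exact h

end Mixture

/-! ### Convergence and Chernoff bounds for the series -/

section MixtureTail

variable {Ω : Type*} [MeasurableSpace Ω] {μ : Measure Ω} [IsProbabilityMeasure μ] {α : ℝ}
  {κ θ : ℕ → Ω → ℝ} {b : ℕ → ℝ}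

lemma ae_summable_mul_bernoulli_mul_exponential (hκ : ∀ n, Measurable (κ n))
    (hθ : ∀ n, Measurable (θ n))
    (h0 : ∀ n, μ.real {ω | κ n ω = 0} = α) (h1 : ∀ n, μ.real {ω | κ n ω = 1} = 1 - α)
    (hlaw : ∀ n, HasLaw (θ n) (expMeasure 1) μ) (hb : ∀ n, 0 ≤ b n) (hbs : Summable b) :
    ∀ᵐ ω ∂μ, Summable fun n => b n * κ n ω * θ n ω := by
  -- The crude 4 comes from x ≤ 2e^{x/2} and E e^{θ/2} = 2; any finite bound on the mean would do.
  have hmean : ∀ n, ∫⁻ ω, ENNReal.ofReal (b n * θ n ω) ∂μ ≤ ENNReal.ofReal (b n) * 4 := by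
    intro n
    have hle : ∀ ω, ENNReal.ofReal (b n * θ n ω)
        ≤ ENNReal.ofReal (b n * 2) * ENNReal.ofReal (Real.exp (1 / 2 * θ n ω)) := by
      intro ω
      rw [← ENNReal.ofReal_mul (mul_nonneg (hb n) zero_le_two), mul_assoc]
      refine ENNReal.ofReal_le_ofReal (mul_le_mul_of_nonneg_left ?_ (hb n))
      linarith [Real.add_one_le_exp (1 / 2 * θ n ω)]
    refine (lintegral_mono hle).trans ?_
    rw [lintegral_const_mul _ (by have := hθ n; fun_prop),
      (hlaw n).lintegral_comp (f := fun x => ENNReal.ofReal (Real.exp (1 / 2 * x)))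
        (by fun_prop), lintegral_exp_mul_expMeasure_one (by norm_num),
      ENNReal.ofReal_mul (hb n), mul_assoc, ← ENNReal.ofReal_mul zero_le_two]
    norm_num
  have hfin : ∫⁻ ω, ∑' n, ENNReal.ofReal (b n * θ n ω) ∂μ ≠ ∞ := by
    rw [lintegral_tsum fun n => by have := hθ n; fun_prop]
    refine ne_top_of_le_ne_top ?_ (ENNReal.tsum_le_tsum hmean)
    rw [ENNReal.tsum_mul_right]
    exact ENNReal.mul_ne_top hbs.tsum_ofReal_ne_top (by simp)
  have hmeas : Measurable fun ω => ∑' n, ENNReal.ofReal (b n * θ n ω) :=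
    Measurable.tsum fun n => by have := hθ n; fun_prop
  filter_upwards [ae_lt_top hmeas hfin, ae_all_iff.2 fun n => ae_eq_zero_or_one (hκ n) (h0 n) (h1 n),
    ae_all_iff.2 fun n => ae_nonneg_of_hasLaw_expMeasure (hθ n) (hlaw n)] with ω hω hk ht
  have hs := ENNReal.summable_toReal hω.ne
  refine Summable.of_nonneg_of_le (fun n => ?_) (fun n => ?_) hs
  · rcases hk n with h | h <;> simp [h, mul_nonneg (hb n) (ht n)]
  · rw [ENNReal.toReal_ofReal (mul_nonneg (hb n) (ht n))]
    rcases hk n with h | h <;> simp [h, mul_nonneg (hb n) (ht n)]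

/-- Each factor is at most exp((1 - α)·c·bₙ) by 1 + u ≤ e^u; Fatou passes from partial sums to the
series. The constant `c` linearises t·b/(1 - t·b) and lets `t` have either sign. -/
lemma lintegral_exp_mul_tsum_le (hκ : ∀ n, Measurable (κ n))
    (hθ : ∀ n, Measurable (θ n)) (hind : iIndepFun (Sum.elim κ θ) μ) (hα : 0 ≤ α) (hα1 : α < 1)
    (h0 : ∀ n, μ.real {ω | κ n ω = 0} = α) (h1 : ∀ n, μ.real {ω | κ n ω = 1} = 1 - α)
    (hlaw : ∀ n, HasLaw (θ n) (expMeasure 1) μ) (hb : ∀ n, 0 ≤ b n) (hbs : Summable b)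
    {t c : ℝ} (ht : ∀ n, t * b n < 1) (hc : ∀ n, t * b n / (1 - t * b n) ≤ c * b n) :
    ∫⁻ ω, ENNReal.ofReal (Real.exp (t * ∑' n, b n * κ n ω * θ n ω)) ∂μ
      ≤ ENNReal.ofReal (Real.exp (c * ((1 - α) * ∑' n, b n))) := by
  let F : ℕ → Ω → ℝ≥0∞ := fun n ω =>
    ∏ i ∈ Finset.range n, ENNReal.ofReal (Real.exp (t * b i * (κ i ω * θ i ω)))
  have hF : ∀ n ω, F n ω
      = ENNReal.ofReal (Real.exp (t * ∑ i ∈ Finset.range n, b i * κ i ω * θ i ω)) := by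
    intro n ω
    simp only [F]
    rw [← ENNReal.ofReal_prod_of_nonneg fun i _ => (Real.exp_pos _).le, ← Real.exp_sum,
      Finset.mul_sum]
    simp only [mul_assoc]
  have hFm : ∀ n, Measurable (F n) := fun n =>
    Finset.measurable_fun_prod _ fun i _ => by have := hκ i; have := hθ i; fun_prop
  have hlim : ∀ᵐ ω ∂μ, ENNReal.ofReal (Real.exp (t * ∑' n, b n * κ n ω * θ n ω))
      = liminf (fun n => F n ω) atTop := by
    filter_upwards [ae_summable_mul_bernoulli_mul_exponential hκ hθ h0 h1 hlaw hb hbs] with ω hω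
    simp_rw [hF]
    have hcont : Continuous fun x => ENNReal.ofReal (Real.exp (t * x)) :=
      ENNReal.continuous_ofReal.comp (by fun_prop)
    exact ((hcont.tendsto _).comp hω.hasSum.tendsto_sum_nat).liminf_eq.symm
  have hint : ∀ n, ∫⁻ ω, F n ω ∂μ
      ≤ ENNReal.ofReal (Real.exp (c * ((1 - α) * ∑ i ∈ Finset.range n, b i))) := by
    intro n
    have hprod := lintegral_prod_eq_prod_lintegral_of_iIndepFun_sumElim hκ hθ hind
      (G := fun i x => ENNReal.ofReal (Real.exp (t * b i * (x.1 * x.2))))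
      (fun i => by fun_prop) n
    simp only [F]
    rw [hprod, Finset.mul_sum, Finset.mul_sum, Real.exp_sum,
      ENNReal.ofReal_prod_of_nonneg fun i _ => (Real.exp_pos _).le]
    refine Finset.prod_le_prod' fun i _ => ?_
    rw [lintegral_exp_bernoulli_mul_exponential (hκ i) (hθ i)
      (hind.indepFun (i := Sum.inl i) (j := Sum.inr i) (by simp)) hα hα1 (h0 i) (h1 i) (hlaw i)
      (ht i)]
    refine ENNReal.ofReal_le_ofReal ((add_comm _ _).le.trans ((Real.add_one_le_exp _).trans
      (Real.exp_le_exp.2 ?_)))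
    rw [mul_left_comm]
    exact mul_le_mul_of_nonneg_left (hc i) (by linarith)
  rw [lintegral_congr_ae hlim]
  refine (lintegral_liminf_le hFm).trans ((liminf_le_liminf (Eventually.of_forall hint)).trans ?_)
  have hcont : Continuous fun x => ENNReal.ofReal (Real.exp (c * ((1 - α) * x))) :=
    ENNReal.continuous_ofReal.comp (by fun_prop)
  exact ((hcont.tendsto _).comp hbs.hasSum.tendsto_sum_nat).liminf_eq.le

/-- Markov's inequality for the exponential. Keeping `t` on both sides of the event yields the upper
tail for t > 0 and the lower tail for t < 0. -/
lemma measureReal_mul_le_mul_tsum_le (hκ : ∀ n, Measurable (κ n))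
    (hθ : ∀ n, Measurable (θ n)) (hind : iIndepFun (Sum.elim κ θ) μ) (hα : 0 ≤ α) (hα1 : α < 1)
    (h0 : ∀ n, μ.real {ω | κ n ω = 0} = α) (h1 : ∀ n, μ.real {ω | κ n ω = 1} = 1 - α)
    (hlaw : ∀ n, HasLaw (θ n) (expMeasure 1) μ) (hb : ∀ n, 0 ≤ b n) (hbs : Summable b)
    {t c : ℝ} (ht : ∀ n, t * b n < 1) (hc : ∀ n, t * b n / (1 - t * b n) ≤ c * b n) (y : ℝ) :
    μ.real {ω | t * y ≤ t * ∑' n, b n * κ n ω * θ n ω}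
      ≤ Real.exp (c * ((1 - α) * ∑' n, b n) - t * y) := by
  have hmeas : Measurable fun ω => ∑' n, b n * κ n ω * θ n ω :=
    Measurable.tsum fun n => ((hκ n).const_mul _).mul (hθ n)
  have hset : {ω | t * y ≤ t * ∑' n, b n * κ n ω * θ n ω}
      = {ω | ENNReal.ofReal (Real.exp (t * y))
        ≤ ENNReal.ofReal (Real.exp (t * ∑' n, b n * κ n ω * θ n ω))} := by
    ext ω
    simp [ENNReal.ofReal_le_ofReal_iff (Real.exp_pos _).le]
  have h := meas_ge_le_lintegral_div (μ := μ)
    (f := fun ω => ENNReal.ofReal (Real.exp (t * ∑' n, b n * κ n ω * θ n ω)))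
    (by fun_prop) (ε := ENNReal.ofReal (Real.exp (t * y)))
    (by simp [Real.exp_pos]) ENNReal.ofReal_ne_top
  rw [hset]
  refine ENNReal.toReal_le_of_le_ofReal (Real.exp_pos _).le (h.trans ?_)
  rw [Real.exp_sub, ENNReal.ofReal_div_of_pos (Real.exp_pos _)]
  gcongr
  exact lintegral_exp_mul_tsum_le hκ hθ hind hα hα1 h0 h1 hlaw hb hbs ht hc

end MixtureTail

/-! ### The two-sided estimate -/

theorem mainTheorem7 :
    ∃ β γ₁₀ γ₁₁ : ℝ, 1 ≤ β ∧ 0 < γ₁₀ ∧ 0 < γ₁₁ ∧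
      ∀ {Ω : Type*} [MeasurableSpace Ω] (μ : Measure Ω) [IsProbabilityMeasure μ]
        (α : ℝ) (_ : 0 ≤ α) (_ : α < 1)
        (κ θ : ℕ → Ω → ℝ)
        (_ : ∀ n, Measurable (κ n)) (_ : ∀ n, Measurable (θ n))
        -- all the variables, of both sequences together, are independent
        (_ : iIndepFun (Sum.elim κ θ) μ)
        (_ : ∀ n, μ.real {ω | κ n ω = 0} = α) (_ : ∀ n, μ.real {ω | κ n ω = 1} = 1 - α)
        -- exponential law with rate, hence expectation, equal to one
        (_ : ∀ n, HasLaw (θ n) (expMeasure 1) μ)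
        (a : ℕ → ℝ) (_ : Antitone a) (_ : ∀ n, 0 ≤ a n) (_ : Summable a) (_ : 0 < a 0),
        (∀ᵐ ω ∂μ, Summable fun n : ℕ => a (n + 1) * κ (n + 1) ω * θ (n + 1) ω) ∧
        ∀ p : ℝ, 2 ≤ p →
          μ.real {ω | γ₁₀ * mixtureScale α a p ≤ mixtureSum a κ θ ω} ≤ Real.exp (-p) ∧
          (1 / 2) * Real.exp (-β * p) ≤
            μ.real {ω | γ₁₁ * mixtureScale α a p ≤ mixtureSum a κ θ ω} := by
  refine ⟨1, 6, 1 / 6, le_rfl, by norm_num, by norm_num, ?_⟩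
  intro Ω _ μ _ α hα hα1 κ θ hκ hθ hind h0 h1 hlaw a ha hnn hsum ha0
  have hbs : Summable fun n => a (n + 1) := (summable_nat_add_iff 1).2 hsum
  have hind' : iIndepFun (Sum.elim (fun n => κ (n + 1)) fun n => θ (n + 1)) μ := by
    have h := hind.precomp (g := Sum.map (· + 1) (· + 1))
      ((add_left_injective 1).sumMap (add_left_injective 1))
    convert! h using 2 with i
    cases i <;> rfl
  have hle : ∀ n, a (n + 1) ≤ a 0 := fun n => ha (Nat.zero_le _)
  have hsummable := ae_summable_mul_bernoulli_mul_exponential (fun n => hκ (n + 1))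
    (fun n => hθ (n + 1)) (fun n => h0 (n + 1)) (fun n => h1 (n + 1)) (fun n => hlaw (n + 1))
    (fun n => hnn (n + 1)) hbs
  have htail := fun {t c : ℝ} => measureReal_mul_le_mul_tsum_le (t := t) (c := c)
    (fun n => hκ (n + 1)) (fun n => hθ (n + 1)) hind' hα hα1 (fun n => h0 (n + 1))
    (fun n => h1 (n + 1)) (fun n => hlaw (n + 1)) (fun n => hnn (n + 1)) hbs
  have hexp : ∀ x : ℝ, 0 ≤ x → μ.real {ω | x ≤ θ 0 ω} = Real.exp (-x) := fun x hx =>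
    ((hlaw 0).measureReal_eq (measurableSet_Ici (a := x))).trans (expMeasure_one_Ici hx)
  refine ⟨hsummable, fun p hp => ?_⟩
  unfold mixtureScale mixtureSum
  set S := ∑' n, a (n + 1)
  set Y : Ω → ℝ := fun ω => ∑' n, a (n + 1) * κ (n + 1) ω * θ (n + 1) ω
  have hS : 0 ≤ (1 - α) * S := mul_nonneg (by linarith) (tsum_nonneg fun n => hnn (n + 1))
  set Q := (1 - α) * S
  constructor
  -- With t = 1/(2a₁), t·aₙ ≤ 1/2, so c = 2t works; the 2Q in the threshold cancels the moment term.
  · have hY : μ.real {ω | 1 / (2 * a 0) * (4 * p * a 0 + 2 * Q) ≤ 1 / (2 * a 0) * Y ω}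
        ≤ Real.exp (1 / a 0 * Q - 1 / (2 * a 0) * (4 * p * a 0 + 2 * Q)) := by
      have hhalf : ∀ n, 1 / (2 * a 0) * a (n + 1) ≤ 1 / 2 := by
        intro n
        rw [one_div_mul_eq_div, div_le_iff₀ (by positivity)]
        linarith [hle n]
      refine htail (fun n => by linarith [hhalf n]) (fun n => ?_) _
      rw [div_le_iff₀ (by linarith [hhalf n])]
      have h2 : 1 / a 0 * a (n + 1) = 2 * (1 / (2 * a 0) * a (n + 1)) := by field_simp
      have h3 : 0 ≤ 1 / (2 * a 0) * a (n + 1) := mul_nonneg (by positivity) (hnn _)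
      rw [h2]
      nlinarith [hhalf n]
    have hE : 1 / a 0 * Q - 1 / (2 * a 0) * (4 * p * a 0 + 2 * Q) = -(2 * p) := by
      field_simp
      ring
    rw [hE] at hY
    have hsub : {ω | 6 * (p * a 0 + Q) ≤ a 0 * θ 0 ω + Y ω}
        ⊆ {ω | 2 * p ≤ θ 0 ω}
          ∪ {ω | 1 / (2 * a 0) * (4 * p * a 0 + 2 * Q) ≤ 1 / (2 * a 0) * Y ω} := by
      intro ω hω
      by_contra hcon
      simp only [Set.mem_union, Set.mem_ofPred_eq, not_or, not_le] at hcon hω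
      have h2 := lt_of_mul_lt_mul_left hcon.2 (by positivity)
      nlinarith [mul_lt_mul_of_pos_left hcon.1 ha0]
    have hp2 : 2 * Real.exp (-(2 * p)) ≤ Real.exp (-p) := by
      have : Real.exp (-(2 * p)) = Real.exp (-p) * Real.exp (-p) := by
        rw [← Real.exp_add]; ring_nf
      have h4 : Real.exp (-p) * Real.exp p = 1 := by rw [← Real.exp_add]; simp
      nlinarith [Real.exp_pos (-p), Real.add_one_le_exp p]
    calc _ ≤ _ := measureReal_mono hsub
      _ ≤ _ := measureReal_union_le _ _
      _ ≤ Real.exp (-(2 * p)) + Real.exp (-(2 * p)) := add_le_add (hexp _ (by linarith)).le hY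
      _ ≤ _ := by linarith
  · have hYnn : ∀ᵐ ω ∂μ, 0 ≤ Y ω := by
      filter_upwards [ae_all_iff.2 fun n => ae_eq_zero_or_one (hκ n) (h0 n) (h1 n),
        ae_all_iff.2 fun n => ae_nonneg_of_hasLaw_expMeasure (hθ n) (hlaw n)] with ω hk ht
      refine tsum_nonneg fun n => ?_
      rcases hk (n + 1) with h | h <;> simp [h, mul_nonneg (hnn (n + 1)) (ht (n + 1))]
    -- The threshold (p·a₁ + Q)/6 is at most p·a₁/2 in the first case and at most Q/4 in the second.
    rcases le_or_gt Q (2 * p * a 0) with hQ | hQ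
    · have hsub : {ω | p / 2 ≤ θ 0 ω}
          ≤ᵐ[μ] {ω | 1 / 6 * (p * a 0 + Q) ≤ a 0 * θ 0 ω + Y ω} := by
        filter_upwards [hYnn] with ω hY hω
        change 1 / 6 * (p * a 0 + Q) ≤ a 0 * θ 0 ω + Y ω
        have : p / 2 ≤ θ 0 ω := hω
        nlinarith [mul_le_mul_of_nonneg_left this ha0.le]
      refine le_trans ?_ (ENNReal.toReal_mono (measure_ne_top _ _) (measure_mono_ae hsub))
      change _ ≤ μ.real _
      rw [hexp _ (by linarith)]
      have : Real.exp (-1 * p) ≤ Real.exp (-(p / 2)) := Real.exp_le_exp.2 (by linarith)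
      linarith [Real.exp_pos (-1 * p)]
    -- Lower tail, t = -1/a₁: with x = aₙ/a₁ ≤ 1, -x/(1 + x) ≤ -x/2. The exponent is -Q/(4a₁) ≤ -1,
    -- as Q > 2p·a₁ ≥ 4a₁; this uses p ≥ 2.
    · have hY : μ.real {ω | -1 / a 0 * (Q / 4) ≤ -1 / a 0 * Y ω}
          ≤ Real.exp (-1 / (2 * a 0) * Q - -1 / a 0 * (Q / 4)) := by
        have hle1 : ∀ n, a (n + 1) / a 0 ≤ 1 := fun n => (div_le_one ha0).2 (hle n)
        have hnn1 : ∀ n, 0 ≤ a (n + 1) / a 0 := fun n => div_nonneg (hnn _) ha0.le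
        have h2 : ∀ n, -1 / a 0 * a (n + 1) = -(a (n + 1) / a 0) := fun n => by ring
        have h3 : ∀ n, -1 / (2 * a 0) * a (n + 1) = -(a (n + 1) / a 0) / 2 := fun n => by
          field_simp
        refine htail (fun n => ?_) (fun n => ?_) _
        · rw [h2]
          linarith [hnn1 n]
        · rw [h2, h3, div_le_iff₀ (by linarith [hnn1 n])]
          nlinarith [hnn1 n, hle1 n]
      have hE : -1 / (2 * a 0) * Q - -1 / a 0 * (Q / 4) ≤ -1 := by
        have : -1 / (2 * a 0) * Q - -1 / a 0 * (Q / 4) = -(Q / (4 * a 0)) := by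
          field_simp
          ring
        rw [this, neg_le_neg_iff, one_le_div (by positivity)]
        nlinarith
      have hhalf : Real.exp (-1) ≤ 1 / 2 := by
        have h4 : Real.exp (-1) * Real.exp 1 = 1 := by rw [← Real.exp_add]; simp
        nlinarith [Real.exp_pos (-1), Real.add_one_le_exp 1]
      have hY' := (hY.trans (Real.exp_le_exp.2 hE)).trans hhalf
      have hcov : (Set.univ : Set Ω)
          ≤ᵐ[μ] ({ω | 1 / 6 * (p * a 0 + Q) ≤ a 0 * θ 0 ω + Y ω}
            ∪ {ω | -1 / a 0 * (Q / 4) ≤ -1 / a 0 * Y ω} : Set Ω) := by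
        filter_upwards [ae_nonneg_of_hasLaw_expMeasure (hθ 0) (hlaw 0)] with ω ht _
        rcases le_total (Y ω) (Q / 4) with h | h
        · exact Or.inr (mul_le_mul_of_nonpos_left h
            (div_nonpos_of_nonpos_of_nonneg (by norm_num) ha0.le))
        · refine Or.inl ?_
          change 1 / 6 * (p * a 0 + Q) ≤ a 0 * θ 0 ω + Y ω
          nlinarith [mul_nonneg ha0.le ht]
      have h1le := (ENNReal.toReal_mono (measure_ne_top _ _) (measure_mono_ae hcov)).trans
        (measureReal_union_le _ _)
      rw [measure_univ, ENNReal.toReal_one] at h1le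
      have hp1 : Real.exp (-1 * p) ≤ 1 := Real.exp_le_one_iff.2 (by linarith)
      linarith
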